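/- Let $X=\{X(t)\}_{t\ge 0}$, $Y=\{Y(t)\}_{t\ge 0}$ and $Z=\{Z(t)\}_{t\ge 0}$ be centered real-valued Gaussian processes with almost surely continuous sample paths, and write $\sigma_X(s,t)=\mathbb{E}[X(s)X(t)]$ and $\sigma_Y(s,t)=\mathbb{E}[Y(s)Y(t)]$. Suppose that for all $s,t\ge 0$ $$\sigma_X(t,t)=\sigma_Y(t,t)\quad\text{and}\quad \sigma_X(s,t)\le\sigma_Y(s,t).$$ Let $1\le r\le n$. For $W\in\{X,Y,Z\}$ let $W_1,\dots,W_n$ be independent copies of $W$ (with almost surely continuous sample paths), and let $W_{r:n}(t)$ be the $r$-th largest of $W_1(t),\dots,W_n(t)$, so that $W_{n:n}(t)=\min_i W_i(t)\le\cdots\le W_{1:n}(t)=\max_i W_i(t)$. Let $c\ge 0$, $T>0$ and $u\in\mathbb{R}$. 1. If $Z$ is independent of $(X_1,\dots,X_n)$ and of $(Y_1,\dots,Y_n)$, then $$\mathbb{P}\Big\{\sup_{t\in[0,T]}\big(X_{r:n}(t)+cZ(t)\big)>u\Big\}\ \ge\ \mathbb{P}\Big\{\sup_{t\in[0,T]}\big(Y_{r:n}(t)+cZ(t)\big)>u\Big\}.$$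 2. If $(Z_1,\dots,Z_n)$ is independent of $X$ and of $Y$, then $$\mathbb{P}\Big\{\sup_{t\in[0,T]}\big(Z_{r:n}(t)+cX(t)\big)>u\Big\}\ \ge\ \mathbb{P}\Big\{\sup_{t\in[0,T]}\big(Z_{r:n}(t)+cY(t)\big)>u\Big\}.$$ -/

import Mathlib

open MeasureTheory ProbabilityTheory
open scoped NNReal

/-- The `r`-th largest of the values `x 0, …, x (n - 1)`, counted with multiplicity, `1 ≤ r ≤ n`:
`r = 1` is the maximum and `r = n` the minimum. `x ∘ Tuple.sort x` lists the values in
nondecreasing order, starting at position `0`. -/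
noncomputable def orderStat {n : ℕ} (r : ℕ) (hr : 1 ≤ r) (hrn : r ≤ n) (x : Fin n → ℝ) : ℝ :=
  x (Tuple.sort x ⟨n - r, by omega⟩)

/-- The covariance function `σ_X(s, t) = E[X(s) X(t)]` of a centered process. -/
noncomputable def covFun {Ω : Type*} [MeasurableSpace Ω] (P : Measure Ω) (X : ℝ≥0 → Ω → ℝ)
    (s t : ℝ≥0) : ℝ :=
  ∫ ω, X s ω * X t ω ∂P

/-- `X` is a centered Gaussian process on `[0, ∞)` with almost surely continuous sample paths. -/
structure IsCenteredContGaussian {Ω : Type*} [MeasurableSpace Ω] (P : Measure Ω)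
    (X : ℝ≥0 → Ω → ℝ) : Prop where
  gaussian : IsGaussianProcess X P
  centered : ∀ t, ∫ ω, X t ω ∂P = 0
  continuous : ∀ᵐ ω ∂P, Continuous fun t ↦ X t ω

/-- `Xs 0, …, Xs (n - 1)` are independent copies of `X`: they are mutually independent as
processes, each has the finite-dimensional distributions of `X`, and each has almost surely
continuous sample paths. -/
structure IsIndepCopies {Ω : Type*} [MeasurableSpace Ω] (P : Measure Ω) {n : ℕ}
    (Xs : Fin n → ℝ≥0 → Ω → ℝ) (X : ℝ≥0 → Ω → ℝ) : Prop where
  indep : iIndepFun (fun j ω t ↦ Xs j t ω) P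
  law : ∀ (j : Fin n) (I : Finset ℝ≥0),
    IdentDistrib (fun ω (t : I) ↦ Xs j t ω) (fun ω (t : I) ↦ X t ω) P P
  continuous : ∀ j, ∀ᵐ ω ∂P, Continuous fun t ↦ Xs j t ω

/-- The order statistics process `X_{r:n}(t)`, generated by `Xs 0, …, Xs (n - 1)`. -/
noncomputable def orderStatProcess {Ω : Type*} {n : ℕ} (r : ℕ) (hr : 1 ≤ r) (hrn : r ≤ n)
    (Xs : Fin n → ℝ≥0 → Ω → ℝ) (t : ℝ≥0) (ω : Ω) : ℝ :=
  orderStat r hr hrn fun j ↦ Xs j t ω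

open Filter Topology

/-! Take complements and restrict to finitely many times. The event for `X_{r:n} + cZ` says that at
every time fewer than `r` of the copies exceed the level `u - cZ(t)`. With `Z` and all copies but
one frozen, by independence and Fubini, this event is empty or a lower orthant for the remaining
copy. Slepian's inequality (`slepian`) compares lower orthants, so the copies can be exchanged one
at a time (`pi_add_count_lt_le`). In the second claim the order statistic is frozen instead and
Slepian is applied once. Path continuity passes from finite sets of times to `[0, T]`
(`measure_lt_iSup_Icc_le`).

Slepian's inequality itself is proved by a Lindeberg-type argument. The orthant indicator is
smoothed to a product of sigmoids at scale `k`. A Taylor expansion compares the two laws up to an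
error `C k³`, uniformly in the thresholds. A centered Gaussian vector has the law of `(x + y)/√2`
with `x`, `y` independent copies of it, so a comparison at scale `k` reduces to two at scale `k/√2`.
Each such halving multiplies the error by `2 · (1/√2)³ < 1`, so iteration removes it. -/

/-! ### Taylor expansion of products of sigmoids. -/

theorem abs_sub_zero_le_of_hasDerivAt {f f' : ℝ → ℝ} {M : ℝ} (hf : ∀ t, HasDerivAt f (f' t) t)
    (hM : ∀ t ∈ Set.Icc (0 : ℝ) 1, |f' t| ≤ M) {t : ℝ} (ht : t ∈ Set.Icc (0 : ℝ) 1) :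
    |f t - f 0| ≤ M := by
  have h := (convex_Icc (0 : ℝ) 1).norm_image_sub_le_of_norm_hasDerivWithin_le
    (fun x _ ↦ (hf x).hasDerivWithinAt) hM (Set.left_mem_Icc.2 zero_le_one) ht
  have h0 : 0 ≤ M := (abs_nonneg _).trans (hM t ht)
  simp only [Real.norm_eq_abs, sub_zero, abs_of_nonneg ht.1] at h
  nlinarith [ht.2]

/-- Second-order Taylor bound on `[0, 1]`. -/
theorem abs_taylor_two_le {g g₁ g₂ g₃ : ℝ → ℝ} {M : ℝ} (h₁ : ∀ t, HasDerivAt g (g₁ t) t)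
    (h₂ : ∀ t, HasDerivAt g₁ (g₂ t) t) (h₃ : ∀ t, HasDerivAt g₂ (g₃ t) t) (hM : ∀ t, |g₃ t| ≤ M) :
    |g 1 - (g 0 + g₁ 0 + g₂ 0 / 2)| ≤ M := by
  -- The bound on the third derivative descends by three uses of the mean value inequality; the
  -- sharp factor `1/6` is not kept.
  have b₂ : ∀ t ∈ Set.Icc (0 : ℝ) 1, |g₂ t - g₂ 0| ≤ M := fun t ht ↦
    abs_sub_zero_le_of_hasDerivAt h₃ (fun t _ ↦ hM t) ht
  have b₁ : ∀ t ∈ Set.Icc (0 : ℝ) 1, |g₁ t - g₁ 0 - t * g₂ 0| ≤ M := fun t ht ↦ by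
    have := abs_sub_zero_le_of_hasDerivAt (f := fun t ↦ g₁ t - t * g₂ 0)
      (fun t ↦ (h₂ t).sub ((hasDerivAt_id' t).mul_const (g₂ 0))) (by simpa using b₂) ht
    convert! this using 2
    ring
  have b₀ := abs_sub_zero_le_of_hasDerivAt (f := fun t ↦ g t - t * g₁ 0 - t ^ 2 * (g₂ 0 / 2))
    (fun t ↦ ((h₁ t).sub ((hasDerivAt_id' t).mul_const (g₁ 0))).sub
      ((hasDerivAt_pow 2 t).mul_const (g₂ 0 / 2)))
    (fun t ht ↦ by convert! b₁ t ht using 2; push_cast; ring) (Set.right_mem_Icc.2 zero_le_one)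
  convert! b₀ using 2
  ring

/-- Second-order expansion of a product of sigmoids, with cubic remainder. -/
theorem abs_prod_sigmoid_sub_taylor_le {ι : Type*} (K : Finset ι) (v b : ι → ℝ) :
    |∏ i ∈ K, (v i + b i).sigmoid - (∏ i ∈ K, (v i).sigmoid) *
      (1 + ∑ i ∈ K, b i * (1 - (v i).sigmoid) +
        ((∑ i ∈ K, b i * (1 - (v i).sigmoid)) ^ 2
          - ∑ i ∈ K, b i ^ 2 * ((v i).sigmoid * (1 - (v i).sigmoid))) / 2)|
      ≤ 6 * (∑ i ∈ K, |b i|) ^ 3 := by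
  classical
  set s : ι → ℝ → ℝ := fun i t ↦ (v i + t * b i).sigmoid with hs
  have s0 : ∀ i t, 0 ≤ s i t := fun i t ↦ Real.sigmoid_nonneg _
  have s1 : ∀ i t, s i t ≤ 1 := fun i t ↦ Real.sigmoid_le_one _
  have ds : ∀ i t, HasDerivAt (s i) (b i * (s i t * (1 - s i t))) t := fun i t ↦ by
    have h : HasDerivAt (fun t ↦ v i + t * b i) (b i) t := by
      simpa using ((hasDerivAt_id' t).mul_const (b i)).const_add (v i)
    have := (Real.hasDerivAt_sigmoid (v i + t * b i)).comp t h
    simpa [mul_comm, hs, Function.comp_def] using this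
  set g : ℝ → ℝ := fun t ↦ ∏ i ∈ K, s i t with hg
  -- Since `(log sigmoid)' = 1 - sigmoid`, `l₀` is the logarithmic derivative of `g`; `l₁` and `l₂`
  -- are its next two derivatives.
  set l₀ : ℝ → ℝ := fun t ↦ ∑ i ∈ K, b i * (1 - s i t) with hl₀
  set l₁ : ℝ → ℝ := fun t ↦ ∑ i ∈ K, -(b i ^ 2 * (s i t * (1 - s i t))) with hl₁
  set l₂ : ℝ → ℝ := fun t ↦ ∑ i ∈ K, -(b i ^ 3 * (s i t * (1 - s i t) * (1 - 2 * s i t))) with hl₂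
  set B := ∑ i ∈ K, |b i| with hB
  have dg : ∀ t, HasDerivAt g (g t * l₀ t) t := fun t ↦ by
    have := HasDerivAt.fun_finsetProd (u := K) (fun i _ ↦ ds i t)
    convert! this using 1
    rw [hl₀, Finset.mul_sum]
    refine Finset.sum_congr rfl fun i hi ↦ ?_
    rw [hg]
    simp only
    rw [← Finset.mul_prod_erase K (fun i ↦ s i t) hi, smul_eq_mul]
    ring
  have dl₀ : ∀ t, HasDerivAt l₀ (l₁ t) t := fun t ↦ by
    refine HasDerivAt.fun_sum fun i _ ↦ ?_
    convert! ((ds i t).const_sub 1).const_mul (b i) using 1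
    ring
  have dl₁ : ∀ t, HasDerivAt l₁ (l₂ t) t := fun t ↦ by
    refine HasDerivAt.fun_sum fun i _ ↦ ?_
    convert! (((ds i t).mul ((ds i t).const_sub 1)).const_mul (b i ^ 2)).neg using 1
    ring
  have d₂ : ∀ t, HasDerivAt (fun t ↦ g t * l₀ t) (g t * (l₀ t ^ 2 + l₁ t)) t := fun t ↦ by
    convert! (dg t).mul (dl₀ t) using 1
    ring
  have d₃ : ∀ t, HasDerivAt (fun t ↦ g t * (l₀ t ^ 2 + l₁ t))
      (g t * (l₀ t ^ 3 + 3 * (l₀ t * l₁ t) + l₂ t)) t := fun t ↦ by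
    convert! (dg t).mul (((dl₀ t).pow 2).add (dl₁ t)) using 1
    simp only [Pi.add_apply, Pi.pow_apply]
    push_cast
    ring
  have hB0 : 0 ≤ B := Finset.sum_nonneg fun i _ ↦ abs_nonneg _
  have hbB : ∀ i ∈ K, |b i| ≤ B := fun i hi ↦
    Finset.single_le_sum (f := fun i ↦ |b i|) (fun i _ ↦ abs_nonneg _) hi
  have sumpow : ∀ m : ℕ, ∑ i ∈ K, |b i| ^ (m + 1) ≤ B ^ (m + 1) := fun m ↦ by
    rw [pow_succ, hB, Finset.mul_sum]
    refine Finset.sum_le_sum fun i hi ↦ ?_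
    rw [pow_succ]
    gcongr
    exact hbB i hi
  have ps : ∀ i t, |s i t * (1 - s i t)| ≤ 1 := fun i t ↦ by
    rw [abs_le]; constructor <;> nlinarith [s0 i t, s1 i t]
  have bl : ∀ (m : ℕ) (c : ι → ℝ), (∀ i, |c i| ≤ 1) →
      |∑ i ∈ K, b i ^ (m + 1) * c i| ≤ B ^ (m + 1) := fun m c hc ↦
    (Finset.abs_sum_le_sum_abs _ _).trans <| (Finset.sum_le_sum fun i _ ↦ by
      rw [abs_mul, abs_pow]
      exact mul_le_of_le_one_right (by positivity) (hc i)).trans (sumpow m)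
  have b₀ : ∀ t, |l₀ t| ≤ B := fun t ↦ by
    simpa using bl 0 (fun i ↦ 1 - s i t) fun i ↦ by
      rw [abs_le]; constructor <;> linarith [s0 i t, s1 i t]
  have b₁ : ∀ t, |l₁ t| ≤ B ^ 2 := fun t ↦ by
    simpa [hl₁] using bl 1 (fun i ↦ s i t * (1 - s i t)) fun i ↦ ps i t
  have b₂ : ∀ t, |l₂ t| ≤ B ^ 3 := fun t ↦ by
    simpa [hl₂] using bl 2 (fun i ↦ s i t * (1 - s i t) * (1 - 2 * s i t)) fun i ↦ by
      rw [abs_mul]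
      refine mul_le_one₀ (ps i t) (abs_nonneg _) ?_
      rw [abs_le]; constructor <;> linarith [s0 i t, s1 i t]
  have bg : ∀ t, |g t| ≤ 1 := fun t ↦ by
    rw [abs_of_nonneg (Finset.prod_nonneg fun i _ ↦ s0 i t)]
    exact Finset.prod_le_one (fun i _ ↦ s0 i t) fun i _ ↦ s1 i t
  have bound : ∀ t, |g t * (l₀ t ^ 3 + 3 * (l₀ t * l₁ t) + l₂ t)| ≤ 6 * B ^ 3 := fun t ↦ by
    have e : |l₀ t ^ 3 + 3 * (l₀ t * l₁ t) + l₂ t| ≤ B ^ 3 + 3 * (B * B ^ 2) + B ^ 3 := by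
      refine (abs_add_le _ _).trans (add_le_add ((abs_add_le _ _).trans (add_le_add ?_ ?_)) (b₂ t))
      · rw [abs_pow]; gcongr; exact b₀ t
      · rw [abs_mul, abs_mul, abs_of_pos (by norm_num : (0 : ℝ) < 3)]
        gcongr
        exacts [b₀ t, b₁ t]
    rw [abs_mul]
    calc _ ≤ 1 * (B ^ 3 + 3 * (B * B ^ 2) + B ^ 3) := by gcongr; exact bg t
      -- The three terms add up to `5 B³`; 6 is merely convenient.
      _ ≤ 6 * B ^ 3 := by nlinarith [pow_nonneg hB0 3]
  have := abs_taylor_two_le dg d₂ d₃ bound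
  convert! this using 2
  simp only [hg, hl₀, hl₁, hs, one_mul, zero_mul, add_zero, Finset.sum_neg_distrib]
  ring

/-- A smooth approximation of the indicator of `{x | ∀ i ∈ K, k * x i ≤ v i}`. -/
noncomputable def sigmoidProd {ι : Type*} (K : Finset ι) (v : ι → ℝ) (k : ℝ) (x : ι → ℝ) : ℝ :=
  ∏ i ∈ K, (v i - k * x i).sigmoid

section

variable {ι : Type*} (K : Finset ι) (v : ι → ℝ) (k : ℝ)

theorem sigmoidProd_nonneg (x : ι → ℝ) : 0 ≤ sigmoidProd K v k x :=
  Finset.prod_nonneg fun _ _ ↦ Real.sigmoid_nonneg _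

theorem sigmoidProd_le_one (x : ι → ℝ) : sigmoidProd K v k x ≤ 1 :=
  Finset.prod_le_one (fun _ _ ↦ Real.sigmoid_nonneg _) fun _ _ ↦ Real.sigmoid_le_one _

theorem norm_sigmoidProd_le_one (x : ι → ℝ) : ‖sigmoidProd K v k x‖ ≤ 1 := by
  rw [Real.norm_of_nonneg (sigmoidProd_nonneg K v k x)]
  exact sigmoidProd_le_one K v k x

theorem continuous_sigmoidProd : Continuous (sigmoidProd K v k) := by
  unfold sigmoidProd
  exact continuous_finsetProd _ fun i _ ↦ continuous_sigmoid.comp (by fun_prop)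

theorem integrable_sigmoidProd_comp [Countable ι] {α : Type*} [MeasurableSpace α] (ρ : Measure α)
    [IsFiniteMeasure ρ] {f : α → ι → ℝ} (hf : Measurable f) :
    Integrable (fun a ↦ sigmoidProd K v k (f a)) ρ :=
  .of_bound ((continuous_sigmoidProd K v k).measurable.comp hf).aestronglyMeasurable 1
    (ae_of_all _ fun _ ↦ norm_sigmoidProd_le_one K v k _)

end

/-! ### Slepian's inequality for Gaussian vectors. -/

section

variable {ι : Type*} [Fintype ι] (μ : Measure (ι → ℝ)) [IsGaussian μ]

theorem memLp_eval_of_isGaussian (i : ι) (p : ENNReal) (hp : p ≠ ⊤) :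
    MemLp (fun x : ι → ℝ ↦ x i) p μ :=
  IsGaussian.memLp_dual μ (ContinuousLinearMap.proj i) p hp

theorem integrable_eval_of_isGaussian (i : ι) : Integrable (fun x : ι → ℝ ↦ x i) μ :=
  memLp_one_iff_integrable.1 (memLp_eval_of_isGaussian μ i 1 (by simp))

theorem integrable_eval_mul_eval_of_isGaussian (i j : ι) :
    Integrable (fun x : ι → ℝ ↦ x i * x j) μ :=
  (memLp_eval_of_isGaussian μ i 2 (by simp)).integrable_mul
    (memLp_eval_of_isGaussian μ j 2 (by simp))

theorem integrable_sum_abs_pow_three_of_isGaussian (K : Finset ι) :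
    Integrable (fun x : ι → ℝ ↦ (∑ i ∈ K, |x i|) ^ 3) μ := by
  have h : MemLp (fun x : ι → ℝ ↦ ∑ i ∈ K, |x i|) 3 μ :=
    memLp_finsetSum _ fun i _ ↦ (memLp_eval_of_isGaussian μ i 3 (by simp)).norm
  refine (h.integrable_norm_pow (p := 3) (by norm_num)).congr (ae_of_all _ fun x ↦ ?_)
  simp only [Real.norm_eq_abs]
  rw [abs_of_nonneg (Finset.sum_nonneg fun i _ ↦ abs_nonneg _)]

/-- Integrating the Taylor expansion kills the linear term, by centering, and leaves second moments
only. The covariances enter with nonnegative weights, and the subtracted sum involves only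
variances. -/
theorem abs_integral_sigmoidProd_sub_le (hμ : ∀ i, ∫ x, x i ∂μ = 0) (K : Finset ι) (v : ι → ℝ)
    {k : ℝ} (hk : 0 ≤ k) :
    |∫ x, sigmoidProd K v k x ∂μ - (∏ i ∈ K, (v i).sigmoid) * (1 + k ^ 2 / 2 *
      (∑ i ∈ K, ∑ j ∈ K, (1 - (v i).sigmoid) * (1 - (v j).sigmoid) * ∫ x, x i * x j ∂μ
        - ∑ i ∈ K, (v i).sigmoid * (1 - (v i).sigmoid) * ∫ x, x i * x i ∂μ))|
      ≤ 6 * k ^ 3 * ∫ x, (∑ i ∈ K, |x i|) ^ 3 ∂μ := by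
  set p := ∏ i ∈ K, (v i).sigmoid with hp
  set w : ι → ℝ := fun i ↦ 1 - (v i).sigmoid with hw
  set q : (ι → ℝ) → ℝ := fun x ↦ p * (1 - k * ∑ i ∈ K, w i * x i + k ^ 2 / 2 *
      (∑ i ∈ K, ∑ j ∈ K, w i * w j * (x i * x j) - ∑ i ∈ K, (v i).sigmoid * w i * (x i * x i)))
    with hq
  have i₁ : Integrable (fun x : ι → ℝ ↦ ∑ i ∈ K, w i * x i) μ :=
    integrable_finsetSum _ fun i _ ↦ (integrable_eval_of_isGaussian μ i).const_mul _
  have i₂ : Integrable (fun x : ι → ℝ ↦ ∑ i ∈ K, ∑ j ∈ K, w i * w j * (x i * x j)) μ :=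
    integrable_finsetSum _ fun i _ ↦ integrable_finsetSum _ fun j _ ↦
      (integrable_eval_mul_eval_of_isGaussian μ i j).const_mul _
  have i₃ : Integrable (fun x : ι → ℝ ↦ ∑ i ∈ K, (v i).sigmoid * w i * (x i * x i)) μ :=
    integrable_finsetSum _ fun i _ ↦ (integrable_eval_mul_eval_of_isGaussian μ i i).const_mul _
  have iq : Integrable q μ :=
    ((((integrable_const 1).sub (i₁.const_mul k)).add ((i₂.sub i₃).const_mul (k ^ 2 / 2)))).const_mul p
  have eq : ∫ x, q x ∂μ = p * (1 + k ^ 2 / 2 *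
      (∑ i ∈ K, ∑ j ∈ K, w i * w j * ∫ x, x i * x j ∂μ
        - ∑ i ∈ K, (v i).sigmoid * w i * ∫ x, x i * x i ∂μ)) := by
    have e₁ : ∫ x : ι → ℝ, ∑ i ∈ K, w i * x i ∂μ = 0 := by
      rw [integral_finsetSum _ fun i _ ↦ (integrable_eval_of_isGaussian μ i).const_mul _]
      simp [integral_const_mul, hμ]
    have e₂ : ∫ x : ι → ℝ, ∑ i ∈ K, ∑ j ∈ K, w i * w j * (x i * x j) ∂μ
        = ∑ i ∈ K, ∑ j ∈ K, w i * w j * ∫ x, x i * x j ∂μ := by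
      rw [integral_finsetSum _ fun i _ ↦ integrable_finsetSum _ fun j _ ↦
        (integrable_eval_mul_eval_of_isGaussian μ i j).const_mul _]
      refine Finset.sum_congr rfl fun i _ ↦ ?_
      rw [integral_finsetSum _ fun j _ ↦
        (integrable_eval_mul_eval_of_isGaussian μ i j).const_mul _]
      simp [integral_const_mul]
    have e₃ : ∫ x : ι → ℝ, ∑ i ∈ K, (v i).sigmoid * w i * (x i * x i) ∂μ
        = ∑ i ∈ K, (v i).sigmoid * w i * ∫ x, x i * x i ∂μ := by
      rw [integral_finsetSum _ fun i _ ↦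
        (integrable_eval_mul_eval_of_isGaussian μ i i).const_mul _]
      simp [integral_const_mul]
    have j₁ : Integrable (fun x : ι → ℝ ↦ 1 - k * ∑ i ∈ K, w i * x i) μ :=
      (integrable_const 1).sub (i₁.const_mul k)
    have j₂ : Integrable (fun x : ι → ℝ ↦ k ^ 2 / 2 * (∑ i ∈ K, ∑ j ∈ K, w i * w j * (x i * x j)
        - ∑ i ∈ K, (v i).sigmoid * w i * (x i * x i))) μ := (i₂.sub i₃).const_mul _
    rw [hq, integral_const_mul, integral_add j₁ j₂, integral_sub (integrable_const 1)
      (i₁.const_mul k), integral_const_mul, integral_const_mul, integral_sub i₂ i₃, e₁, e₂, e₃]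
    simp
  have iF : Integrable (sigmoidProd K v k) μ := integrable_sigmoidProd_comp K v k μ measurable_id
  rw [← eq, ← integral_sub iF iq, ← integral_const_mul]
  refine (abs_integral_le_integral_abs).trans (integral_mono
    (iF.sub iq).abs
    ((integrable_sum_abs_pow_three_of_isGaussian μ K).const_mul _) fun x ↦ ?_)
  have := abs_prod_sigmoid_sub_taylor_le K v fun i ↦ -(k * x i)
  simp only [abs_neg, abs_mul, abs_of_nonneg hk, ← Finset.mul_sum, mul_pow] at this
  rw [mul_assoc]
  refine le_of_eq_of_le ?_ this
  congr 2
  have a₁ : ∑ i ∈ K, -(k * x i) * (1 - (v i).sigmoid) = -(k * ∑ i ∈ K, w i * x i) := by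
    rw [Finset.mul_sum, ← Finset.sum_neg_distrib]
    exact Finset.sum_congr rfl fun i _ ↦ by rw [hw]; ring
  have a₂ : ∑ i ∈ K, (-(k * x i)) ^ 2 * ((v i).sigmoid * (1 - (v i).sigmoid))
      = k ^ 2 * ∑ i ∈ K, (v i).sigmoid * w i * (x i * x i) := by
    rw [Finset.mul_sum]
    exact Finset.sum_congr rfl fun i _ ↦ by rw [hw]; ring
  have a₃ : ∑ i ∈ K, ∑ j ∈ K, w i * w j * (x i * x j) = (∑ i ∈ K, w i * x i) ^ 2 := by
    rw [sq, Finset.sum_mul_sum]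
    exact Finset.sum_congr rfl fun i _ ↦ Finset.sum_congr rfl fun j _ ↦ by ring
  rw [a₁, a₂, hq]
  simp only
  rw [a₃]
  ring

/-- The product of a centered Gaussian law with itself is invariant under rotation by `π/4`; this is
its first marginal. -/
theorem map_add_mul_sqrt_two_div_two (hμ : ∀ i, ∫ x, x i ∂μ = 0) :
    (μ.prod μ).map (fun p ↦ (√2 / 2) • (p.1 + p.2)) = μ := by
  have h0 : μ[id] = 0 := by
    ext i
    exact (IsGaussian.integral_dual (μ := μ) (ContinuousLinearMap.proj i)).symm.trans (hμ i)
  have h : ((μ.prod μ).map (ContinuousLinearMap.rotation (Real.pi / 4))).map Prod.fst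
      = (μ.prod μ).map Prod.fst := by rw [IsGaussian.map_rotation_eq_self h0]
  rw [Measure.map_map measurable_fst (by fun_prop), Measure.map_fst_prod] at h
  simp only [measure_univ, one_smul] at h
  convert! h using 2
  ext p i
  simp [ContinuousLinearMap.rotation_apply, mul_add]

variable (ν : Measure (ι → ℝ)) [IsGaussian ν]

/-- The second-order terms are ordered by the covariance hypothesis, leaving the cubic remainders.
`C` must not depend on `v`, because the halving step shifts `v` by random amounts. -/
theorem exists_integral_sigmoidProd_sub_le (hμ : ∀ i, ∫ x, x i ∂μ = 0) (hν : ∀ i, ∫ x, x i ∂ν = 0)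
    (hvar : ∀ i, ∫ x, x i * x i ∂μ = ∫ x, x i * x i ∂ν)
    (hcov : ∀ i j, ∫ x, x i * x j ∂μ ≤ ∫ x, x i * x j ∂ν) (K : Finset ι) :
    ∃ C, ∀ (v : ι → ℝ) (k : ℝ), 0 ≤ k →
      ∫ x, sigmoidProd K v k x ∂μ ≤ ∫ x, sigmoidProd K v k x ∂ν + C * k ^ 3 := by
  refine ⟨6 * ∫ x, (∑ i ∈ K, |x i|) ^ 3 ∂μ + 6 * ∫ x, (∑ i ∈ K, |x i|) ^ 3 ∂ν, fun v k hk ↦ ?_⟩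
  have h₁ := (abs_le.1 (abs_integral_sigmoidProd_sub_le μ hμ K v hk)).2
  have h₂ := (abs_le.1 (abs_integral_sigmoidProd_sub_le ν hν K v hk)).1
  have h₃ : (∏ i ∈ K, (v i).sigmoid) * (1 + k ^ 2 / 2 *
      (∑ i ∈ K, ∑ j ∈ K, (1 - (v i).sigmoid) * (1 - (v j).sigmoid) * ∫ x, x i * x j ∂μ
        - ∑ i ∈ K, (v i).sigmoid * (1 - (v i).sigmoid) * ∫ x, x i * x i ∂μ))
      ≤ (∏ i ∈ K, (v i).sigmoid) * (1 + k ^ 2 / 2 *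
      (∑ i ∈ K, ∑ j ∈ K, (1 - (v i).sigmoid) * (1 - (v j).sigmoid) * ∫ x, x i * x j ∂ν
        - ∑ i ∈ K, (v i).sigmoid * (1 - (v i).sigmoid) * ∫ x, x i * x i ∂ν)) := by
    simp only [hvar]
    have : ∀ i, 0 ≤ 1 - (v i).sigmoid := fun i ↦ sub_nonneg.2 (Real.sigmoid_le_one _)
    have hp : 0 ≤ ∏ i ∈ K, (v i).sigmoid := Finset.prod_nonneg fun _ _ ↦ Real.sigmoid_nonneg _
    refine mul_le_mul_of_nonneg_left (add_le_add_right (mul_le_mul_of_nonneg_left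
      (sub_le_sub_right (Finset.sum_le_sum fun i _ ↦ Finset.sum_le_sum fun j _ ↦
        mul_le_mul_of_nonneg_left (hcov i j) (mul_nonneg (this i) (this j))) _)
      (by positivity)) _) hp
  nlinarith

theorem integral_sigmoidProd_eq_integral_integral (hμ : ∀ i, ∫ x, x i ∂μ = 0) (K : Finset ι)
    (v : ι → ℝ) (k : ℝ) :
    ∫ x, sigmoidProd K v k x ∂μ =
      ∫ y, ∫ x, sigmoidProd K (fun i ↦ v i - k * (√2 / 2) * y i) (k * (√2 / 2)) x ∂μ ∂μ := by
  conv_lhs => rw [← map_add_mul_sqrt_two_div_two μ hμ]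
  have hm : Measurable fun p : (ι → ℝ) × (ι → ℝ) ↦ (√2 / 2) • (p.1 + p.2) := by fun_prop
  rw [integral_map hm.aemeasurable (continuous_sigmoidProd K v k).aestronglyMeasurable,
    integral_prod _ (integrable_sigmoidProd_comp K v k _ hm)]
  refine integral_congr_ae (ae_of_all _ fun y ↦ integral_congr_ae (ae_of_all _ fun x ↦ ?_))
  simp only [sigmoidProd, Pi.smul_apply, Pi.add_apply, smul_eq_mul]
  refine Finset.prod_congr rfl fun i _ ↦ ?_
  congr 1
  ring

/-- Each integral splits into two independent halves at scale `k/√2`. Conditionally on one half, the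
other sees only shifted thresholds, so exchanging `μ` for `ν` costs `e` per half. -/
theorem integral_sigmoidProd_le_add_two_mul (hμ : ∀ i, ∫ x, x i ∂μ = 0)
    (hν : ∀ i, ∫ x, x i ∂ν = 0) (K : Finset ι) {k e : ℝ}
    (h : ∀ v : ι → ℝ, ∫ x, sigmoidProd K v (k * (√2 / 2)) x ∂μ
      ≤ ∫ x, sigmoidProd K v (k * (√2 / 2)) x ∂ν + e) (v : ι → ℝ) :
    ∫ x, sigmoidProd K v k x ∂μ ≤ ∫ x, sigmoidProd K v k x ∂ν + 2 * e := by
  rw [integral_sigmoidProd_eq_integral_integral μ hμ, integral_sigmoidProd_eq_integral_integral ν hν]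
  set F : (ι → ℝ) → (ι → ℝ) → ℝ := fun y x ↦
    sigmoidProd K (fun i ↦ v i - k * (√2 / 2) * y i) (k * (√2 / 2)) x with hF
  have symm : ∀ x y, F x y = F y x := fun x y ↦ by
    simp only [hF, sigmoidProd]
    exact Finset.prod_congr rfl fun i _ ↦ by congr 1; ring
  have Fe : ∀ y x, F y x = sigmoidProd K v (k * (√2 / 2)) (x + y) := fun y x ↦ by
    simp only [hF, sigmoidProd, Pi.add_apply]
    exact Finset.prod_congr rfl fun i _ ↦ by congr 1; ring
  have ii : ∀ (ρ₁ ρ₂ : Measure (ι → ℝ)) [IsProbabilityMeasure ρ₁] [IsProbabilityMeasure ρ₂],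
      Integrable (fun p : (ι → ℝ) × (ι → ℝ) ↦ F p.1 p.2) (ρ₁.prod ρ₂) := fun ρ₁ ρ₂ _ _ ↦ by
    simp only [Fe]
    exact integrable_sigmoidProd_comp K v _ _ (by fun_prop)
  have step : ∀ (ρ : Measure (ι → ℝ)) [IsProbabilityMeasure ρ],
      ∫ y, ∫ x, F y x ∂μ ∂ρ ≤ ∫ y, ∫ x, F y x ∂ν ∂ρ + e := fun ρ _ ↦ by
    calc ∫ y, ∫ x, F y x ∂μ ∂ρ ≤ ∫ y, (∫ x, F y x ∂ν + e) ∂ρ :=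
          integral_mono (ii ρ μ).integral_prod_left
            ((ii ρ ν).integral_prod_left.add (integrable_const e)) fun y ↦ h _
      _ = _ := by rw [integral_add (ii ρ ν).integral_prod_left (integrable_const e)]; simp
  -- The mixed terms, one half from each law, agree because the integrand is symmetric in the
  -- halves.
  have swap : ∫ y, ∫ x, F y x ∂ν ∂μ = ∫ y, ∫ x, F y x ∂μ ∂ν := by
    rw [integral_integral_swap (ii μ ν)]
    simp only [symm]
  have s₁ := step μ
  have s₂ := step ν
  linarith

theorem integral_sigmoidProd_le (hμ : ∀ i, ∫ x, x i ∂μ = 0) (hν : ∀ i, ∫ x, x i ∂ν = 0)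
    (hvar : ∀ i, ∫ x, x i * x i ∂μ = ∫ x, x i * x i ∂ν)
    (hcov : ∀ i j, ∫ x, x i * x j ∂μ ≤ ∫ x, x i * x j ∂ν) (K : Finset ι) (v : ι → ℝ) {k : ℝ}
    (hk : 0 ≤ k) : ∫ x, sigmoidProd K v k x ∂μ ≤ ∫ x, sigmoidProd K v k x ∂ν := by
  obtain ⟨C, hC⟩ := exists_integral_sigmoidProd_sub_le μ ν hμ hν hvar hcov K
  have key : ∀ (m : ℕ) (k : ℝ), 0 ≤ k → ∀ v : ι → ℝ, ∫ x, sigmoidProd K v k x ∂μ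
      ≤ ∫ x, sigmoidProd K v k x ∂ν + C * k ^ 3 * (√2 / 2) ^ m := by
    intro m
    induction m with
    | zero => intro k hk v; simpa using hC v k hk
    | succ m ih =>
      intro k hk v
      refine (integral_sigmoidProd_le_add_two_mul μ ν hμ hν K
        (ih (k * (√2 / 2)) (by positivity)) v).trans_eq ?_
      have : √2 ^ 2 = 2 := Real.sq_sqrt zero_le_two
      -- The cube of the scale gains `√2/4`; doubling for the two halves leaves the ratio `√2/2 <
      -- 1`.
      have h3 : (k * (√2 / 2)) ^ 3 = k ^ 3 * (√2 / 2) / 2 := by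
        rw [show (k * (√2 / 2)) ^ 3 = k ^ 3 * (√2 ^ 2 * √2 / 8) by ring, this]
        ring
      rw [h3]
      ring
  have h1 : √2 / 2 < 1 := by
    nlinarith [Real.sq_sqrt (zero_le_two (α := ℝ)), Real.sqrt_nonneg 2]
  have lim := ((tendsto_pow_atTop_nhds_zero_of_lt_one (by positivity) h1).const_mul
    (C * k ^ 3)).const_add (∫ x, sigmoidProd K v k x ∂ν)
  rw [mul_zero, add_zero] at lim
  exact ge_of_tendsto' lim fun m ↦ key m k hk v

theorem tendsto_sigmoidProd_indicator {ι : Type*} (K : Finset ι) (u x : ι → ℝ) :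
    Tendsto (fun m : ℕ ↦ sigmoidProd K (fun i ↦ (m : ℝ) ^ 2 * u i + m) ((m : ℝ) ^ 2) x) atTop
      (𝓝 ({x : ι → ℝ | ∀ i ∈ K, x i ≤ u i}.indicator (fun _ ↦ (1 : ℝ)) x)) := by
  classical
  have h : Tendsto (fun m : ℕ ↦ sigmoidProd K (fun i ↦ (m : ℝ) ^ 2 * u i + m) ((m : ℝ) ^ 2) x) atTop
      (𝓝 (∏ i ∈ K, if x i ≤ u i then 1 else 0)) := by
    refine tendsto_finsetProd _ fun i _ ↦ ?_
    -- The extra `+ m` makes the factor tend to 1 also at `x i = u i`, so the limit is the closed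
    -- orthant.
    have e : ∀ m : ℕ, (m : ℝ) ^ 2 * u i + m - (m : ℝ) ^ 2 * x i
        = (m : ℝ) * ((m : ℝ) * (u i - x i) + 1) := fun m ↦ by ring
    simp only [e]
    split_ifs with hx
    · refine Real.tendsto_sigmoid_atTop.comp (tendsto_atTop_mono (fun m ↦ ?_)
        tendsto_natCast_atTop_atTop)
      have : 0 ≤ (m : ℝ) * (u i - x i) := mul_nonneg m.cast_nonneg (sub_nonneg.2 hx)
      nlinarith [(m.cast_nonneg : (0 : ℝ) ≤ m)]
    · refine Real.tendsto_sigmoid_atBot.comp (tendsto_natCast_atTop_atTop.atTop_mul_atBot₀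
        (tendsto_atBot_add_const_right _ _ (tendsto_natCast_atTop_atTop.atTop_mul_const_of_neg
          (by linarith))))
  convert h using 2
  rw [Finset.prod_ite_zero]
  simp [Set.indicator_apply]

theorem measurableSet_forall_mem_le {ι : Type*} [Countable ι] (K : Finset ι) (u : ι → ℝ) :
    MeasurableSet {x : ι → ℝ | ∀ i ∈ K, x i ≤ u i} := by
  simp only [Set.ofPred_forall]
  exact .iInter fun i ↦ .iInter fun _ ↦ measurableSet_le (measurable_pi_apply i) measurable_const

/-- **Slepian's inequality**. -/
theorem slepian (hμ : ∀ i, ∫ x, x i ∂μ = 0) (hν : ∀ i, ∫ x, x i ∂ν = 0)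
    (hvar : ∀ i, ∫ x, x i * x i ∂μ = ∫ x, x i * x i ∂ν)
    (hcov : ∀ i j, ∫ x, x i * x j ∂μ ≤ ∫ x, x i * x j ∂ν) (K : Finset ι) (u : ι → ℝ) :
    μ {x | ∀ i ∈ K, x i ≤ u i} ≤ ν {x | ∀ i ∈ K, x i ≤ u i} := by
  have lim : ∀ (ρ : Measure (ι → ℝ)) [IsProbabilityMeasure ρ], Tendsto (fun m : ℕ ↦
      ∫ x, sigmoidProd K (fun i ↦ (m : ℝ) ^ 2 * u i + m) ((m : ℝ) ^ 2) x ∂ρ) atTop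
      (𝓝 (ρ.real {x | ∀ i ∈ K, x i ≤ u i})) := fun ρ _ ↦ by
    rw [← integral_indicator_one (measurableSet_forall_mem_le K u)]
    exact tendsto_integral_of_dominated_convergence (fun _ ↦ 1)
      (fun m ↦ (continuous_sigmoidProd _ _ _).aestronglyMeasurable) (integrable_const 1)
      (fun m ↦ ae_of_all _ fun x ↦ norm_sigmoidProd_le_one _ _ _ x)
      (ae_of_all _ fun x ↦ tendsto_sigmoidProd_indicator K u x)
  have := le_of_tendsto_of_tendsto' (lim μ) (lim ν) fun m ↦
    integral_sigmoidProd_le μ ν hμ hν hvar hcov K _ (by positivity)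
  exact (ENNReal.toReal_le_toReal (measure_ne_top _ _) (measure_ne_top _ _)).1 this

end

/-! ### Counting exceedances of independent vectors. -/

theorem measurableSet_add_count_lt {ι : Type*} [Finite ι] (u : ι → ℝ) (r n : ℕ) :
    MeasurableSet {p : (Fin n → ι → ℝ) × (ι → ℕ) |
      ∀ i, p.2 i + ∑ j, (if u i < p.1 j i then 1 else 0) < r} := by
  rw [Set.ofPred_forall]
  refine .iInter fun i ↦ measurableSet_lt ?_ measurable_const
  refine (by fun_prop : Measurable fun p : (Fin n → ι → ℝ) × (ι → ℕ) ↦ p.2 i).add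
    (Finset.measurable_fun_sum _ fun j _ ↦
      Measurable.ite (measurableSet_lt measurable_const (by fun_prop)) measurable_const
        measurable_const)

/-- If `μ` gives smaller mass than `ν` to all lower orthants, then for `n` independent vectors with
law `μ` it is less likely that few of them exceed the levels `u`. -/
theorem pi_add_count_lt_le {ι : Type*} [Finite ι] (μ ν : Measure (ι → ℝ)) [IsProbabilityMeasure μ]
    [IsProbabilityMeasure ν] (u : ι → ℝ)
    (h : ∀ K : Finset ι, μ {x | ∀ i ∈ K, x i ≤ u i} ≤ ν {x | ∀ i ∈ K, x i ≤ u i})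
    (r n : ℕ) (m : ι → ℕ) :
    Measure.pi (fun _ : Fin n ↦ μ) {x | ∀ i, m i + ∑ j, (if u i < x j i then 1 else 0) < r} ≤
      Measure.pi (fun _ : Fin n ↦ ν) {x | ∀ i, m i + ∑ j, (if u i < x j i then 1 else 0) < r} := by
  classical
  have := Fintype.ofFinite ι
  -- The initial counts `m` absorb the exceedances of the vector split off.
  induction n generalizing m with
  | zero =>
    refine le_of_eq (congrArg (fun ρ : Measure (Fin 0 → ι → ℝ) ↦ ρ _) ?_)
    rw [Measure.pi_of_empty, Measure.pi_of_empty]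
  | succ n ih =>
    set b : (ι → ℝ) → ι → ℕ := fun x i ↦ m i + if u i < x i then 1 else 0 with hb
    have mb : Measurable b := measurable_pi_lambda _ fun i ↦ measurable_const.add
      (Measurable.ite (measurableSet_lt measurable_const (by fun_prop)) measurable_const
        measurable_const)
    set S : Set ((ι → ℝ) × (Fin n → ι → ℝ)) :=
      {p | ∀ i, b p.1 i + ∑ j, (if u i < p.2 j i then 1 else 0) < r} with hS
    have mS : MeasurableSet S := (measurableSet_add_count_lt u r n).preimage
      (measurable_snd.prodMk (mb.comp measurable_fst))
    have toProd : ∀ (ρ : Measure (ι → ℝ)) [IsProbabilityMeasure ρ],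
        Measure.pi (fun _ : Fin (n + 1) ↦ ρ)
          {x | ∀ i, m i + ∑ j, (if u i < x j i then 1 else 0) < r}
          = (ρ.prod (Measure.pi fun _ : Fin n ↦ ρ)) S := fun ρ _ ↦ by
      rw [← (measurePreserving_piFinSuccAbove (fun _ : Fin (n + 1) ↦ ρ) 0).measure_preimage
        mS.nullMeasurableSet]
      congr 1
      ext x
      simp only [hS, hb, Fin.sum_univ_succ, ← add_assoc]
      rfl
    rw [toProd μ, toProd ν]
    calc (μ.prod (Measure.pi fun _ : Fin n ↦ μ)) S
        ≤ (μ.prod (Measure.pi fun _ : Fin n ↦ ν)) S := by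
          rw [Measure.prod_apply mS, Measure.prod_apply mS]
          exact lintegral_mono fun x ↦ ih (b x)
      _ ≤ (ν.prod (Measure.pi fun _ : Fin n ↦ ν)) S := by
          rw [Measure.prod_apply_symm mS, Measure.prod_apply_symm mS]
          refine lintegral_mono fun y ↦ ?_
          set N : ι → ℕ := fun i ↦ m i + ∑ j, (if u i < y j i then 1 else 0) with hN
          -- If the frozen counts stay below `r`, the free vector is constrained only at indices
          -- where one more exceedance would reach `r`: a lower orthant. Otherwise the section is
          -- empty.
          by_cases hr : ∀ i, N i < r
          · have e : (fun x ↦ (x, y)) ⁻¹' S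
                = {x | ∀ i ∈ Finset.univ.filter (fun i ↦ r ≤ N i + 1), x i ≤ u i} := by
              ext x
              simp only [hS, hb, Set.mem_preimage, Set.mem_ofPred_eq, Finset.mem_filter,
                Finset.mem_univ, true_and]
              refine forall_congr' fun i ↦ ?_
              have := hr i
              simp only [hN] at this ⊢
              split_ifs with hx
              · have := not_le.2 hx
                constructor
                · intro h1 h2; omega
                · intro h1
                  by_contra h2
                  exact this (h1 (by omega))
              · constructor
                · intro _ _; exact not_lt.1 hx
                · intro _; omega
            simp only [e]
            exact h _
          · have e : (fun x ↦ (x, y)) ⁻¹' S = ∅ := by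
              ext x
              simp only [hS, hb, Set.mem_preimage, Set.mem_ofPred_eq, Set.mem_empty_iff_false,
                iff_false]
              contrapose! hr
              intro i
              have := hr i
              simp only [hN]
              omega
            simp [e]

/-! ### Order statistics through exceedance counts. -/

section

variable {n : ℕ} (r : ℕ) (hr : 1 ≤ r) (hrn : r ≤ n)

theorem orderStat_le_iff (x : Fin n → ℝ) (a : ℝ) :
    orderStat r hr hrn x ≤ a ↔ ∑ j, (if a < x j then 1 else 0) < r := by
  set σ := Tuple.sort x with hσ
  have mono : Monotone (x ∘ σ) := Tuple.monotone_sort x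
  rw [← Equiv.sum_comp σ, ← Finset.card_filter]
  set q : Fin n := ⟨n - r, by omega⟩ with hq
  change x (σ q) ≤ a ↔ _
  constructor
  · intro h
    have sub : Finset.univ.filter (fun j ↦ a < x (σ j)) ⊆ Finset.Ioi q := fun j hj ↦ by
      rw [Finset.mem_Ioi]
      by_contra hjq
      exact absurd (((Finset.mem_filter.1 hj).2).trans_le (mono (not_lt.1 hjq))) (not_lt.2 h)
    refine (Finset.card_le_card sub).trans_lt ?_
    rw [Fin.card_Ioi]
    simp only [hq]
    omega
  · intro h
    by_contra! ha
    have sub : Finset.Ici q ⊆ Finset.univ.filter (fun j ↦ a < x (σ j)) := fun j hj ↦ by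
      simpa using ha.trans_le (mono (Finset.mem_Ici.1 hj))
    have := Finset.card_le_card sub
    rw [Fin.card_Ici] at this
    simp only [hq] at this
    omega

/-- If `x j` exceeds a level raised by `dist x y`, then `y j` exceeds the original one, so the count
of exceedances cannot grow. -/
theorem lipschitzWith_orderStat : LipschitzWith 1 (orderStat r hr hrn) := by
  refine LipschitzWith.of_le_add fun x y ↦ (orderStat_le_iff r hr hrn x _).2 ?_
  refine lt_of_le_of_lt (Finset.sum_le_sum fun j _ ↦ ?_)
    ((orderStat_le_iff r hr hrn y _).1 le_rfl)
  have : x j - y j ≤ dist x y := (le_abs_self _).trans (dist_le_pi_dist x y j)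
  split_ifs with h₁ h₂ <;> first | omega | (exfalso; linarith)

theorem continuous_orderStat : Continuous (orderStat r hr hrn) :=
  (lipschitzWith_orderStat r hr hrn).continuous

variable {ι : Type*} [Finite ι] (c u : ℝ)

theorem measurableSet_orderStat_add_le :
    MeasurableSet {p : (Fin n → ι → ℝ) × (ι → ℝ) |
      ∀ i, orderStat r hr hrn (fun j ↦ p.1 j i) + c * p.2 i ≤ u} := by
  rw [Set.ofPred_forall]
  have := (continuous_orderStat r hr hrn).measurable
  exact .iInter fun i ↦ measurableSet_le (by fun_prop) measurable_const

variable (μ ν : Measure (ι → ℝ)) [IsProbabilityMeasure μ] [IsProbabilityMeasure ν]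

theorem pi_prod_orderStat_add_le
    (h : ∀ (K : Finset ι) (v : ι → ℝ), μ {x | ∀ i ∈ K, x i ≤ v i} ≤ ν {x | ∀ i ∈ K, x i ≤ v i})
    (ζ : Measure (ι → ℝ)) [SFinite ζ] :
    (Measure.pi fun _ : Fin n ↦ μ).prod ζ
        {p | ∀ i, orderStat r hr hrn (fun j ↦ p.1 j i) + c * p.2 i ≤ u} ≤
      (Measure.pi fun _ : Fin n ↦ ν).prod ζ
        {p | ∀ i, orderStat r hr hrn (fun j ↦ p.1 j i) + c * p.2 i ≤ u} := by
  have mS := measurableSet_orderStat_add_le (ι := ι) r hr hrn c u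
  rw [Measure.prod_apply_symm mS, Measure.prod_apply_symm mS]
  refine lintegral_mono fun z ↦ ?_
  have := pi_add_count_lt_le μ ν (fun i ↦ u - c * z i) (fun K ↦ h K _) r n 0
  simp only [Pi.zero_apply, zero_add, ← orderStat_le_iff r hr hrn, le_sub_iff_add_le] at this
  exact this

theorem prod_orderStat_add_le
    (h : ∀ (K : Finset ι) (v : ι → ℝ), μ {x | ∀ i ∈ K, x i ≤ v i} ≤ ν {x | ∀ i ∈ K, x i ≤ v i})
    (hc : 0 ≤ c) (ρ : Measure (Fin n → ι → ℝ)) [SFinite ρ] :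
    ρ.prod μ {p | ∀ i, orderStat r hr hrn (fun j ↦ p.1 j i) + c * p.2 i ≤ u} ≤
      ρ.prod ν {p | ∀ i, orderStat r hr hrn (fun j ↦ p.1 j i) + c * p.2 i ≤ u} := by
  have mS := measurableSet_orderStat_add_le (ι := ι) r hr hrn c u
  rw [Measure.prod_apply mS, Measure.prod_apply mS]
  refine lintegral_mono fun z ↦ ?_
  simp only [Set.preimage_ofPred_eq]
  -- For `c = 0` the vector drops out of the event; otherwise division by `c` turns the event into a
  -- lower orthant.
  rcases hc.eq_or_lt with rfl | hc
  · by_cases hz : ∀ i, orderStat r hr hrn (fun j ↦ z j i) ≤ u <;> simp [hz]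
  · have := Fintype.ofFinite ι
    have e : ∀ x : ι → ℝ, (∀ i, orderStat r hr hrn (fun j ↦ z j i) + c * x i ≤ u) ↔
        ∀ i ∈ Finset.univ, x i ≤ (u - orderStat r hr hrn (fun j ↦ z j i)) / c := fun x ↦ by
      simp only [Finset.mem_univ, true_imp_iff, le_div_iff₀ hc, le_sub_iff_add_le, add_comm,
        mul_comm]
    simp only [e]
    exact h _ _

end

/-! ### From vectors to processes. -/

section

variable {Ω : Type*} [MeasurableSpace Ω] {P : Measure Ω}

theorem IsCenteredContGaussian.slepian [IsProbabilityMeasure P] {X Y : ℝ≥0 → Ω → ℝ}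
    (hX : IsCenteredContGaussian P X) (hY : IsCenteredContGaussian P Y)
    (hvar : ∀ t, covFun P X t t = covFun P Y t t)
    (hcov : ∀ s t, covFun P X s t ≤ covFun P Y s t) (I : Finset ℝ≥0) (K : Finset I) (v : I → ℝ) :
    P.map (fun ω (t : I) ↦ X t ω) {x | ∀ i ∈ K, x i ≤ v i} ≤
      P.map (fun ω (t : I) ↦ Y t ω) {x | ∀ i ∈ K, x i ≤ v i} := by
  have gX : HasGaussianLaw (fun ω (t : I) ↦ X t ω) P := hX.gaussian.hasGaussianLaw I
  have gY : HasGaussianLaw (fun ω (t : I) ↦ Y t ω) P := hY.gaussian.hasGaussianLaw I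
  have := gX.isGaussian_map
  have := gY.isGaussian_map
  have m₁ : ∀ {W : ℝ≥0 → Ω → ℝ}, HasGaussianLaw (fun ω (t : I) ↦ W t ω) P → ∀ i : I,
      ∫ x, x i ∂P.map (fun ω (t : I) ↦ W t ω) = ∫ ω, W i ω ∂P := fun g i ↦
    integral_map g.aemeasurable (measurable_pi_apply i).aestronglyMeasurable
  have m₂ : ∀ {W : ℝ≥0 → Ω → ℝ}, HasGaussianLaw (fun ω (t : I) ↦ W t ω) P → ∀ i j : I,
      ∫ x, x i * x j ∂P.map (fun ω (t : I) ↦ W t ω) = covFun P W i j := fun g i j ↦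
    integral_map g.aemeasurable (by fun_prop)
  refine _root_.slepian _ _ ?_ ?_ ?_ ?_ K v
  · intro i; rw [m₁ gX, hX.centered]
  · intro i; rw [m₁ gY, hY.centered]
  · intro i; rw [m₂ gX, m₂ gY, hvar]
  · intro i j; rw [m₂ gX, m₂ gY]; exact hcov _ _

theorem IsIndepCopies.aemeasurable {n : ℕ} {Xs : Fin n → ℝ≥0 → Ω → ℝ} {X : ℝ≥0 → Ω → ℝ}
    (h : IsIndepCopies P Xs X) (I : Finset ℝ≥0) :
    AEMeasurable (fun ω j (t : I) ↦ Xs j t ω) P :=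
  aemeasurable_pi_lambda _ fun j ↦ (h.law j I).aemeasurable_fst

theorem IsIndepCopies.map_prod_eq [IsProbabilityMeasure P] {n : ℕ}
    {Xs : Fin n → ℝ≥0 → Ω → ℝ} {X W : ℝ≥0 → Ω → ℝ}
    (h : IsIndepCopies P Xs X) (I : Finset ℝ≥0) (hW : AEMeasurable (fun ω (t : I) ↦ W t ω) P)
    (hind : IndepFun (fun ω j t ↦ Xs j t ω) (fun ω t ↦ W t ω) P) :
    P.map (fun ω ↦ (fun j (t : I) ↦ Xs j t ω, fun t : I ↦ W t ω)) =
      (Measure.pi fun _ : Fin n ↦ P.map (fun ω (t : I) ↦ X t ω)).prod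
        (P.map (fun ω (t : I) ↦ W t ω)) := by
  have h₁ : IndepFun (fun ω j (t : I) ↦ Xs j t ω) (fun ω (t : I) ↦ W t ω) P :=
    hind.comp (φ := fun (f : Fin n → ℝ≥0 → ℝ) j (t : I) ↦ f j t)
      (ψ := fun (f : ℝ≥0 → ℝ) (t : I) ↦ f t) (by fun_prop) (by fun_prop)
  have h₂ : iIndepFun (fun j ω (t : I) ↦ Xs j t ω) P :=
    h.indep.comp (fun _ (f : ℝ≥0 → ℝ) (t : I) ↦ f t) fun _ ↦ by fun_prop
  rw [(indepFun_iff_map_prod_eq_prod_map_map (h.aemeasurable I) hW).1 h₁,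
    (iIndepFun_iff_map_fun_eq_pi_map fun j ↦ (h.law j I).aemeasurable_fst).1 h₂]
  simp only [fun j ↦ (h.law j I).map_eq]

theorem IsIndepCopies.ae_continuous_orderStatProcess_add {n : ℕ} {Xs : Fin n → ℝ≥0 → Ω → ℝ}
    {X W : ℝ≥0 → Ω → ℝ} (h : IsIndepCopies P Xs X) (hW : ∀ᵐ ω ∂P, Continuous fun t ↦ W t ω)
    (r : ℕ) (hr : 1 ≤ r) (hrn : r ≤ n) (c : ℝ) :
    ∀ᵐ ω ∂P, Continuous fun t ↦ orderStatProcess r hr hrn Xs t ω + c * W t ω := by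
  filter_upwards [ae_all_iff.2 h.continuous, hW] with ω h₁ h₂
  exact ((continuous_orderStat r hr hrn).comp (continuous_pi h₁)).add (h₂.const_mul c)

/-- Writes the probability through the product law alone, so that the vector comparisons apply. -/
theorem IsIndepCopies.measure_exists_lt [IsProbabilityMeasure P] {n : ℕ} {Xs : Fin n → ℝ≥0 → Ω → ℝ}
    {X W : ℝ≥0 → Ω → ℝ} (h : IsIndepCopies P Xs X) (I : Finset ℝ≥0)
    (hX : AEMeasurable (fun ω (t : I) ↦ X t ω) P)
    (hW : AEMeasurable (fun ω (t : I) ↦ W t ω) P)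
    (hind : IndepFun (fun ω j t ↦ Xs j t ω) (fun ω t ↦ W t ω) P)
    (r : ℕ) (hr : 1 ≤ r) (hrn : r ≤ n) (c u : ℝ) :
    P {ω | ∃ t ∈ I, u < orderStatProcess r hr hrn Xs t ω + c * W t ω} =
      1 - (Measure.pi fun _ : Fin n ↦ P.map (fun ω (t : I) ↦ X t ω)).prod
        (P.map (fun ω (t : I) ↦ W t ω))
          {p | ∀ i, orderStat r hr hrn (fun j ↦ p.1 j i) + c * p.2 i ≤ u} := by
  have mS := measurableSet_orderStat_add_le (ι := I) r hr hrn c u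
  have := Measure.isProbabilityMeasure_map hX
  have := Measure.isProbabilityMeasure_map hW
  rw [← prob_compl_eq_one_sub mS, ← h.map_prod_eq I hW hind,
    Measure.map_apply_of_aemeasurable ((h.aemeasurable I).prodMk hW) mS.compl]
  congr 1
  ext ω
  simp [orderStatProcess]

/-- Exceeding `u` strictly is an open condition on times, hence visible on a dense sequence.
Compactness bounds the path, so the real supremum is not a default value. -/
theorem lt_iSup_Icc_iff_exists_denseSeq {T : ℝ≥0} {f : ℝ≥0 → ℝ} (hf : Continuous f) (u : ℝ) :
    u < ⨆ t : Set.Icc (0 : ℝ≥0) T, f t ↔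
      ∃ m, u < f (haveI : Nonempty (Set.Icc (0 : ℝ≥0) T) := ⟨⟨0, by simp⟩⟩
        TopologicalSpace.denseSeq (Set.Icc (0 : ℝ≥0) T) m) := by
  have : Nonempty (Set.Icc (0 : ℝ≥0) T) := ⟨⟨0, by simp⟩⟩
  have hf' : Continuous fun t : Set.Icc (0 : ℝ≥0) T ↦ f t := hf.comp continuous_subtype_val
  rw [lt_ciSup_iff (isCompact_range hf').bddAbove]
  constructor
  · rintro ⟨t, ht⟩
    obtain ⟨_, h, m, rfl⟩ := (TopologicalSpace.denseRange_denseSeq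
      (Set.Icc (0 : ℝ≥0) T)).inter_open_nonempty _ (isOpen_lt continuous_const hf') ⟨t, ht⟩
    exact ⟨m, h⟩
  · rintro ⟨m, hm⟩
    exact ⟨_, hm⟩

/-- Comparison of the suprema of two processes with continuous paths from that over finite sets. -/
theorem measure_lt_iSup_Icc_le {A B : ℝ≥0 → Ω → ℝ} (hA : ∀ᵐ ω ∂P, Continuous fun t ↦ A t ω)
    (hB : ∀ᵐ ω ∂P, Continuous fun t ↦ B t ω) (T : ℝ≥0) (u : ℝ)
    (h : ∀ I : Finset ℝ≥0, P {ω | ∃ t ∈ I, u < A t ω} ≤ P {ω | ∃ t ∈ I, u < B t ω}) :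
    P {ω | u < ⨆ t : Set.Icc (0 : ℝ≥0) T, A t ω} ≤ P {ω | u < ⨆ t : Set.Icc (0 : ℝ≥0) T, B t ω} := by
  classical
  have : Nonempty (Set.Icc (0 : ℝ≥0) T) := ⟨⟨0, by simp⟩⟩
  set d : ℕ → ℝ≥0 := fun m ↦ TopologicalSpace.denseSeq (Set.Icc (0 : ℝ≥0) T) m with hd
  set I : ℕ → Finset ℝ≥0 := fun m ↦ (Finset.range m).image d with hI
  have key : ∀ {W : ℝ≥0 → Ω → ℝ}, (∀ᵐ ω ∂P, Continuous fun t ↦ W t ω) →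
      P {ω | u < ⨆ t : Set.Icc (0 : ℝ≥0) T, W t ω} = ⨆ m, P {ω | ∃ t ∈ I m, u < W t ω} := by
    intro W hW
    have mono : Monotone fun m ↦ {ω | ∃ t ∈ I m, u < W t ω} := fun a b hab ω ⟨t, ht, h⟩ ↦
      ⟨t, Finset.image_subset_image (Finset.range_mono hab) ht, h⟩
    rw [← mono.measure_iUnion]
    -- Paths are continuous only almost surely, so the events agree up to a null set.
    refine measure_congr ?_
    filter_upwards [hW] with ω hω
    refine propext ((lt_iSup_Icc_iff_exists_denseSeq hω u).trans ?_)
    change _ ↔ ω ∈ ⋃ m, {ω | ∃ t ∈ I m, u < W t ω}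
    simp only [Set.mem_iUnion, Set.mem_ofPred_eq, hI, Finset.exists_mem_image, Finset.mem_range]
    exact ⟨fun ⟨m, hm⟩ ↦ ⟨m + 1, m, m.lt_succ_self, hm⟩, fun ⟨_, m, _, hm⟩ ↦ ⟨m, hm⟩⟩
  rw [key hA, key hB]
  exact iSup_mono fun m ↦ h _

end

theorem mainTheorem5 {Ω : Type*} [MeasurableSpace Ω] (P : Measure Ω) [IsProbabilityMeasure P]
    (X Y Z : ℝ≥0 → Ω → ℝ)
    (hX : IsCenteredContGaussian P X) (hY : IsCenteredContGaussian P Y)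
    (hZ : IsCenteredContGaussian P Z)
    (hvar : ∀ t, covFun P X t t = covFun P Y t t)
    (hcov : ∀ s t, covFun P X s t ≤ covFun P Y s t)
    (n r : ℕ) (hr : 1 ≤ r) (hrn : r ≤ n)
    (c : ℝ) (hc : 0 ≤ c) (T : ℝ≥0) (hT : 0 < T) (u : ℝ) :
    (∀ Xs Ys : Fin n → ℝ≥0 → Ω → ℝ,
      IsIndepCopies P Xs X → IsIndepCopies P Ys Y →
      IndepFun (fun ω j t ↦ Xs j t ω) (fun ω t ↦ Z t ω) P →
      IndepFun (fun ω j t ↦ Ys j t ω) (fun ω t ↦ Z t ω) P →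
      P {ω | u < ⨆ t : Set.Icc (0 : ℝ≥0) T, (orderStatProcess r hr hrn Xs t ω + c * Z t ω)} ≥
        P {ω | u < ⨆ t : Set.Icc (0 : ℝ≥0) T, (orderStatProcess r hr hrn Ys t ω + c * Z t ω)}) ∧
    (∀ Zs : Fin n → ℝ≥0 → Ω → ℝ,
      IsIndepCopies P Zs Z →
      IndepFun (fun ω j t ↦ Zs j t ω) (fun ω t ↦ X t ω) P →
      IndepFun (fun ω j t ↦ Zs j t ω) (fun ω t ↦ Y t ω) P →
      P {ω | u < ⨆ t : Set.Icc (0 : ℝ≥0) T, (orderStatProcess r hr hrn Zs t ω + c * X t ω)} ≥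
        P {ω | u < ⨆ t : Set.Icc (0 : ℝ≥0) T, (orderStatProcess r hr hrn Zs t ω + c * Y t ω)}) := by

  have aem : ∀ {W : ℝ≥0 → Ω → ℝ}, IsCenteredContGaussian P W → ∀ I : Finset ℝ≥0,
      AEMeasurable (fun ω (t : I) ↦ W t ω) P := fun h I ↦ (h.gaussian.hasGaussianLaw I).aemeasurable
  have sl := hX.slepian hY hvar hcov
  refine ⟨fun Xs Ys hXs hYs hXZ hYZ ↦ ?_, fun Zs hZs hZX hZY ↦ ?_⟩
  · refine measure_lt_iSup_Icc_le
      (hYs.ae_continuous_orderStatProcess_add hZ.continuous r hr hrn c)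
      (hXs.ae_continuous_orderStatProcess_add hZ.continuous r hr hrn c) T u fun I ↦ ?_
    rw [hXs.measure_exists_lt I (aem hX I) (aem hZ I) hXZ,
      hYs.measure_exists_lt I (aem hY I) (aem hZ I) hYZ]
    have := Measure.isProbabilityMeasure_map (aem hX I)
    have := Measure.isProbabilityMeasure_map (aem hY I)
    -- Complements reverse the order: lower orthants are less likely for `X`, so exceedances are
    -- more likely.
    exact tsub_le_tsub_left (pi_prod_orderStat_add_le r hr hrn c u _ _ (sl I) _) 1
  · refine measure_lt_iSup_Icc_le
      (hZs.ae_continuous_orderStatProcess_add hY.continuous r hr hrn c)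
      (hZs.ae_continuous_orderStatProcess_add hX.continuous r hr hrn c) T u fun I ↦ ?_
    rw [hZs.measure_exists_lt I (aem hZ I) (aem hX I) hZX,
      hZs.measure_exists_lt I (aem hZ I) (aem hY I) hZY]
    have := Measure.isProbabilityMeasure_map (aem hX I)
    have := Measure.isProbabilityMeasure_map (aem hY I)
    have := Measure.isProbabilityMeasure_map (aem hZ I)
    exact tsub_le_tsub_left (prod_orderStat_add_le r hr hrn c u _ _ (sl I) hc _) 1
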